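/- Let $G$ be a plane graph, that is, a simple graph (finite or infinite) together with an embedding in $\mathbb{R}^2$: the vertices are distinct points, every edge is a simple curve (an injective continuous image of $[0,1]$) joining the points of its two end vertices and containing no other vertex, and two different edges meet only in common end points. Let $X$ be a cycle in $G$ (with at least three vertices), and let $C\subset\mathbb{R}^2$ be the union of the curves representing the edges of $X$. Say that two vertices not on $C$ are on the same side of $X$ if they lie in the same connected component of $\mathbb{R}^2\setminus C$. If a vertex $x$ of $G$ is adjacent to every vertex of $X$, then there is no vertex $y\neq x$ of $G$ such that $y$ is on the same side of $X$ as $x$ and $y$ is adjacent to every vertex of $X$. -/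

import Mathlib

/-- The Euclidean plane. -/
abbrev Plane : Type := EuclideanSpace ℝ (Fin 2)

/-- An embedding of a simple graph in the plane: distinct vertices are distinct points, every
edge is a simple curve joining its end vertices, a curve passes through no vertex except the
ends of its edge, and two different curves meet only at common end points. A plane graph is a
graph together with such an embedding. -/
structure PlaneEmbedding {V : Type*} (G : SimpleGraph V) where
  /-- the point that represents a vertex -/
  point : V → Plane
  /-- the curve, as a set of points, that represents an edge -/
  curve : G.edgeSet → Set Plane
  point_injective : Function.Injective point
  curve_isArc : ∀ (u v : V) (h : G.Adj u v), ∃ γ : Path (point u) (point v),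
    Function.Injective γ ∧ Set.range γ = curve ⟨s(u, v), h⟩
  mem_of_point_mem_curve : ∀ (e : G.edgeSet) (w : V), point w ∈ curve e → w ∈ (e : Sym2 V)
  curve_inter : ∀ e f : G.edgeSet, e ≠ f → ∀ p ∈ curve e ∩ curve f,
    ∃ w : V, w ∈ (e : Sym2 V) ∧ w ∈ (f : Sym2 V) ∧ p = point w

namespace PlaneEmbedding

variable {V : Type*} {G : SimpleGraph V}

/-- The union of the curves that represent the edges of a walk; a closed curve if the walk is a
cycle. -/
def walkCurve (E : PlaneEmbedding G) {u v : V} (X : G.Walk u v) : Set Plane :=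
  ⋃ e ∈ {e : G.edgeSet | (e : Sym2 V) ∈ X.edges}, E.curve e

/-- `x` and `y` are on the same side of `X`: they are off the curve of `X` and in the same
connected component of its complement (`connectedComponentIn F p` is empty if `p ∉ F`, and
contained in `F` always). -/
def SameSide (E : PlaneEmbedding G) {u v : V} (X : G.Walk u v) (x y : V) : Prop :=
  E.point y ∈ connectedComponentIn (E.walkCurve X)ᶜ (E.point x)

end PlaneEmbedding

/-! Suppose `x` and `y` lie on the same side of the cycle. Three vertices of the cycle give three
arcs from `x` to `y`, disjoint except for their ends, and the cycle contains curves joining the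
middles of these arcs in pairs, each avoiding the third arc. This is excluded by counting arguments
of differences (`not_isPreconnected_of_three_arcs`).

For two arcs γ, δ, a logarithm of γ(s) − δ(t) on the square without two corners compares the two
views from the middles; the discrepancy contains 2m with m an odd multiple of πi
(`exists_logIncrement_sub_eq`). Winding numbers are constant on connected sets off a closed curve
(`logIncrement_triangle_eq`). This is used for the six triangles formed by half arcs and one joining
curve, and for the closed curve of all three joining curves, seen from `x` and `y`. Adding up,
everything cancels except the three values m, so three odd multiples of πi would sum to 0. -/

open Set

/-! ### Continuous logarithms -/

/-- A nowhere vanishing continuous function on a contractible space has a continuous logarithm. -/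
theorem exists_continuousMap_exp_eq {A : Type*} [TopologicalSpace A] [ContractibleSpace A]
    (f : C(A, ℂ)) (hf : ∀ a, f a ≠ 0) : ∃ L : C(A, ℂ), ∀ a, Complex.exp (L a) = f a := by
  let g : C(A, {z : ℂ // z ≠ 0}) := ⟨fun a ↦ ⟨f a, hf a⟩, by fun_prop⟩
  obtain ⟨a₀, ⟨H⟩⟩ := id_nullhomotopic A
  -- The reversed contraction runs from a constant map, whose lift through `exp` is constant, to the
  -- identity; the lifted homotopy at time 1 is the logarithm.
  let H' : C(unitInterval × A, {z : ℂ // z ≠ 0}) := g.comp (H.symm : C(unitInterval × A, A))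
  have h0 : ∀ a, H' (0, a) = (fun z : ℂ ↦ (⟨_, z.exp_ne_zero⟩ : {z : ℂ // z ≠ 0}))
      (ContinuousMap.const A (Complex.log (f a₀)) a) := by
    intro a
    apply Subtype.ext
    simp [H', g, Complex.exp_log (hf a₀)]
  let Λ := Complex.isCoveringMap_exp.liftHomotopy H' _ h0
  refine ⟨Λ.comp ((ContinuousMap.const A 1).prodMk (ContinuousMap.id A)), fun a ↦ ?_⟩
  have h := congrArg Subtype.val
    (congrFun (Complex.isCoveringMap_exp.liftHomotopy_lifts H' _ h0) (1, a))
  simpa [H', g, -IsCoveringMap.liftHomotopy_apply] using h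

/-- A nowhere vanishing continuous function on a star-convex set has a continuous logarithm. -/
theorem StarConvex.exists_continuousOn_exp_eq {E : Type*} [AddCommGroup E] [Module ℝ E]
    [TopologicalSpace E] [ContinuousAdd E] [ContinuousSMul ℝ E] {S : Set E} {c : E}
    (hS : StarConvex ℝ c S) (hne : S.Nonempty) {f : E → ℂ} (hc : ContinuousOn f S)
    (hf : ∀ p ∈ S, f p ≠ 0) :
    ∃ L : E → ℂ, ContinuousOn L S ∧ ∀ p ∈ S, Complex.exp (L p) = f p := by
  classical
  have := hS.contractibleSpace hne
  obtain ⟨L, hL⟩ := exists_continuousMap_exp_eq (A := S) ⟨S.domRestrict f, hc.domRestrict⟩ fun p ↦ hf p p.2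
  refine ⟨fun p ↦ if h : p ∈ S then L ⟨p, h⟩ else 0, ?_, fun p hp ↦ by
    simp only [hp, dite_true]
    exact hL ⟨p, hp⟩⟩
  rw [continuousOn_iff_continuous_domRestrict]
  convert L.continuous using 1
  ext p
  simp [p.2]

/-- A continuous function on a preconnected set all of whose values have exponential `1` is
constant. -/
theorem IsPreconnected.eq_of_exp_eq_one {E : Type*} [TopologicalSpace E] {K : Set E}
    (hK : IsPreconnected K) {w : E → ℂ} (hw : ContinuousOn w K)
    (h1 : ∀ p ∈ K, Complex.exp (w p) = 1) {p q : E} (hp : p ∈ K) (hq : q ∈ K) : w p = w q := by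
  have : DiscreteTopology (AddSubgroup.zmultiples (2 * Real.pi * Complex.I)) :=
    NormedSpace.discreteTopology_zmultiples _
  refine hK.constant_of_mapsTo (T := (AddSubgroup.zmultiples (2 * Real.pi * Complex.I) : Set ℂ))
    ⟨this⟩ hw (fun r hr ↦ ?_) hp hq
  obtain ⟨n, hn⟩ := Complex.exp_eq_one_iff.1 (h1 r hr)
  exact ⟨n, by simp [hn]⟩

/-! ### The increment of a logarithm along an interval -/

open Classical in
/-- The increment over `[a, b]` of a continuous logarithm of `f` (and `0` if there is none). -/
noncomputable def logIncrement (f : ℝ → ℂ) (a b : ℝ) : ℂ :=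
  if h : ∃ L : ℝ → ℂ, ContinuousOn L (Icc a b) ∧ ∀ t ∈ Icc a b, Complex.exp (L t) = f t then
    h.choose b - h.choose a else 0

/-- Two continuous logarithms on an interval differ by a constant, so the choice in `logIncrement`
is immaterial. -/
theorem logIncrement_eq {f L : ℝ → ℂ} {a b : ℝ} (hab : a ≤ b) (hL : ContinuousOn L (Icc a b))
    (h : ∀ t ∈ Icc a b, Complex.exp (L t) = f t) : logIncrement f a b = L b - L a := by
  have hex : ∃ L : ℝ → ℂ, ContinuousOn L (Icc a b) ∧ ∀ t ∈ Icc a b, Complex.exp (L t) = f t :=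
    ⟨L, hL, h⟩
  rw [logIncrement, dif_pos hex]
  obtain ⟨hM, hMf⟩ := hex.choose_spec
  have := isPreconnected_Icc.eq_of_exp_eq_one (hM.sub hL) (fun t ht ↦ by
    rw [Pi.sub_apply, Complex.exp_sub, hMf t ht, h t ht, div_self]
    exact h t ht ▸ Complex.exp_ne_zero _) (right_mem_Icc.2 hab) (left_mem_Icc.2 hab)
  simp only [Pi.sub_apply] at this
  linear_combination this

theorem exists_log_of_continuousOn_Icc {f : ℝ → ℂ} {a b : ℝ} (hab : a ≤ b)
    (hf : ContinuousOn f (Icc a b)) (h0 : ∀ t ∈ Icc a b, f t ≠ 0) :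
    ∃ L : ℝ → ℂ, ContinuousOn L (Icc a b) ∧ ∀ t ∈ Icc a b, Complex.exp (L t) = f t :=
  ((convex_Icc a b).starConvex (left_mem_Icc.2 hab)).exists_continuousOn_exp_eq
    ⟨a, left_mem_Icc.2 hab⟩ hf h0

theorem exp_logIncrement {f : ℝ → ℂ} {a b : ℝ} (hab : a ≤ b)
    (hf : ContinuousOn f (Icc a b)) (h0 : ∀ t ∈ Icc a b, f t ≠ 0) :
    Complex.exp (logIncrement f a b) = f b / f a := by
  obtain ⟨L, hL, h⟩ := exists_log_of_continuousOn_Icc hab hf h0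
  rw [logIncrement_eq hab hL h, Complex.exp_sub, h _ (right_mem_Icc.2 hab),
    h _ (left_mem_Icc.2 hab)]

theorem logIncrement_add {f : ℝ → ℂ} {a b c : ℝ} (hab : a ≤ b) (hbc : b ≤ c)
    (hf : ContinuousOn f (Icc a c)) (h0 : ∀ t ∈ Icc a c, f t ≠ 0) :
    logIncrement f a b + logIncrement f b c = logIncrement f a c := by
  obtain ⟨L, hL, h⟩ := exists_log_of_continuousOn_Icc (hab.trans hbc) hf h0
  have h1 : Icc a b ⊆ Icc a c := Icc_subset_Icc_right hbc
  have h2 : Icc b c ⊆ Icc a c := Icc_subset_Icc_left hab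
  rw [logIncrement_eq (hab.trans hbc) hL h,
    logIncrement_eq hab (hL.mono h1) fun t ht ↦ h t (h1 ht),
    logIncrement_eq hbc (hL.mono h2) fun t ht ↦ h t (h2 ht)]
  ring

theorem logIncrement_reverse {f : ℝ → ℂ} (hf : Continuous f)
    (h0 : ∀ t ∈ Icc (0 : ℝ) 1, f t ≠ 0) :
    logIncrement (fun t ↦ f (1 - t)) 0 1 = -logIncrement f 0 1 := by
  obtain ⟨L, hL, h⟩ := exists_log_of_continuousOn_Icc zero_le_one hf.continuousOn h0
  have hmaps : MapsTo (fun t : ℝ ↦ 1 - t) (Icc 0 1) (Icc 0 1) := fun t ht ↦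
    ⟨by linarith [ht.2], by linarith [ht.1]⟩
  rw [logIncrement_eq zero_le_one hL h,
    logIncrement_eq (L := fun t ↦ L (1 - t)) zero_le_one (hL.comp (by fun_prop) hmaps)
      fun t ht ↦ h _ (hmaps ht)]
  simp

/-- The increment of the logarithm of `f - p` depends continuously on the point `p`. -/
theorem continuousOn_logIncrement_sub {f : ℝ → ℂ} {a b : ℝ} (hab : a ≤ b)
    (hf : ContinuousOn f (Icc a b)) :
    ContinuousOn (fun p : ℂ ↦ logIncrement (fun t ↦ f t - p) a b) (f '' Icc a b)ᶜ := by
  intro p hp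
  apply ContinuousAt.continuousWithinAt
  have hopen : IsOpen (f '' Icc a b)ᶜ :=
    (isCompact_Icc.image_of_continuousOn hf).isClosed.isOpen_compl
  obtain ⟨r, hr, hball⟩ := Metric.isOpen_iff.1 hopen p hp
  -- A joint logarithm in the parameter and the base point makes the increment a difference of two
  -- continuous functions.
  have hstar : StarConvex ℝ (a, p) (Icc a b ×ˢ Metric.ball p r) :=
    ((convex_Icc a b).prod (convex_ball p r)).starConvex
      ⟨left_mem_Icc.2 hab, Metric.mem_ball_self hr⟩
  obtain ⟨L, hL, h⟩ := hstar.exists_continuousOn_exp_eq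
    ⟨(a, p), left_mem_Icc.2 hab, Metric.mem_ball_self hr⟩ (f := fun q ↦ f q.1 - q.2)
    ((hf.comp continuousOn_fst fun q hq ↦ hq.1).sub continuousOn_snd)
    fun q hq h ↦ hball hq.2 ⟨q.1, hq.1, sub_eq_zero.1 h⟩
  have hcont : ∀ t ∈ Icc a b, ContinuousOn (fun q ↦ L (t, q)) (Metric.ball p r) := fun t ht ↦
    hL.comp (by fun_prop) fun q hq ↦ ⟨ht, hq⟩
  have heq : EqOn (fun q : ℂ ↦ logIncrement (fun t ↦ f t - q) a b)
      (fun q ↦ L (b, q) - L (a, q)) (Metric.ball p r) := fun q hq ↦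
    logIncrement_eq (L := fun t ↦ L (t, q)) hab
      (hL.comp (by fun_prop) fun t ht ↦ ⟨ht, hq⟩) fun t ht ↦ h (t, q) ⟨ht, hq⟩
  exact (((hcont b (right_mem_Icc.2 hab)).sub (hcont a (left_mem_Icc.2 hab))).congr
    heq).continuousAt (Metric.ball_mem_nhds p hr)

/-! ### Three arcs with common ends -/

/-- The square `[0, 1]²` without the corners `(0, 0)` and `(1, 1)`. -/
def puncturedSquare : Set (ℝ × ℝ) :=
  {q | q.1 ∈ Icc 0 1 ∧ q.2 ∈ Icc 0 1 ∧ q ≠ (0, 0) ∧ q ≠ (1, 1)}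

theorem mem_puncturedSquare {s t : ℝ} (hs0 : 0 ≤ s) (hs1 : s ≤ 1) (ht0 : 0 ≤ t) (ht1 : t ≤ 1)
    (h0 : 0 < s + t) (h1 : s + t < 2) : (s, t) ∈ puncturedSquare := by
  refine ⟨⟨hs0, hs1⟩, ⟨ht0, ht1⟩, fun e ↦ ?_, fun e ↦ ?_⟩ <;>
  · rw [Prod.mk.injEq] at e
    linarith

/-- The removed corners are extreme points of the square, so a segment from the centre could meet
them only at its far end. -/
theorem starConvex_puncturedSquare : StarConvex ℝ ((1 / 2, 1 / 2) : ℝ × ℝ) puncturedSquare := by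
  rintro ⟨s, t⟩ ⟨⟨hs0, hs1⟩, ⟨ht0, ht1⟩, h0, h1⟩ a b ha hb hab
  simp only [puncturedSquare, mem_ofPred_eq, Prod.smul_mk, Prod.mk_add_mk, smul_eq_mul, ne_eq,
    Prod.mk.injEq, not_and, mem_Icc] at *
  refine ⟨⟨by positivity, by nlinarith⟩, ⟨by positivity, by nlinarith⟩, fun h h' ↦ ?_,
    fun h h' ↦ ?_⟩
  · have ha0 : a = 0 := by nlinarith [mul_nonneg hb hs0]
    have hb1 : b = 1 := by linarith
    subst ha0 hb1
    exact h0 (by linarith) (by linarith)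
  · have ha0 : a = 0 := by nlinarith [mul_nonneg hb (sub_nonneg.2 hs1)]
    have hb1 : b = 1 := by linarith
    subst ha0 hb1
    exact h1 (by linarith) (by linarith)

/-- For two arcs from `x` to `y` that meet only in their ends, the increments of the argument along
each of them seen from the middle of the other one differ, up to terms that depend on one of
the arcs only, by twice an odd multiple of `π`. -/
theorem exists_logIncrement_sub_eq {γ δ : ℝ → ℂ} {x y : ℂ} (hγ : Continuous γ) (hδ : Continuous δ)
    (hγ0 : γ 0 = x) (hγ1 : γ 1 = y) (hδ0 : δ 0 = x) (hδ1 : δ 1 = y)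
    (hne : ∀ q ∈ puncturedSquare, γ q.1 ≠ δ q.2) :
    ∃ m : ℂ, Complex.exp m = -1 ∧
      logIncrement (fun t ↦ γ t - δ (1 / 2)) 0 1 - logIncrement (fun t ↦ δ t - γ (1 / 2)) 0 1 =
        2 * m +
        (logIncrement (fun t ↦ δ t - y) 0 (1 / 2) + logIncrement (fun t ↦ δ t - x) (1 / 2) 1) -
        (logIncrement (fun t ↦ γ t - y) 0 (1 / 2) + logIncrement (fun t ↦ γ t - x) (1 / 2) 1) := by
  obtain ⟨L, hL, h⟩ := starConvex_puncturedSquare.exists_continuousOn_exp_eq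
    ⟨(1, 0), by simp [puncturedSquare]⟩ (f := fun q ↦ γ q.1 - δ q.2) (by fun_prop)
    fun q hq ↦ sub_ne_zero.2 (hne q hq)
  have hrow : ∀ {a b c : ℝ}, a ≤ b → (∀ t ∈ Icc a b, (t, c) ∈ puncturedSquare) →
      logIncrement (fun t ↦ γ t - δ c) a b = L (b, c) - L (a, c) := fun hab hc ↦
    logIncrement_eq (L := fun t ↦ L (t, _)) hab (hL.comp (by fun_prop) hc) fun t ht ↦ h _ (hc t ht)
  have hcol : ∀ {a b c : ℝ}, a ≤ b → (∀ t ∈ Icc a b, (c, t) ∈ puncturedSquare) →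
      logIncrement (fun t ↦ δ t - γ c) a b = L (c, b) - L (c, a) := fun {a b c} hab hc ↦ by
    -- Adding πi changes the sign of the difference of the arcs.
    rw [logIncrement_eq (L := fun t ↦ L (c, t) + Real.pi * Complex.I) hab
      ((hL.comp (by fun_prop) hc).add continuousOn_const) fun t ht ↦ ?_]
    · ring
    · rw [Complex.exp_add, Complex.exp_pi_mul_I, h _ (hc t ht)]
      ring
  have hxy : x ≠ y := by
    rw [← hγ0, ← hδ1]
    exact hne (0, 1) (by simp [puncturedSquare])
  -- At the two remaining corners the difference of the arcs is y − x and x − y.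
  refine ⟨L (1, 0) - L (0, 1), ?_, ?_⟩
  · rw [Complex.exp_sub, h _ (by simp [puncturedSquare]), h _ (by simp [puncturedSquare])]
    simp only [hγ0, hγ1, hδ0, hδ1]
    rw [div_eq_iff (sub_ne_zero.2 hxy)]
    ring
  · rw [hrow zero_le_one, hcol zero_le_one]
    -- With `x` and `y` written as ends of the other arc, the four half increments are taken along
    -- the sides of the square.
    · nth_rw 1 [← hγ1]
      nth_rw 1 [← hγ0]
      nth_rw 1 [← hδ1]
      nth_rw 1 [← hδ0]
      rw [hrow (by norm_num), hrow (by norm_num), hcol (by norm_num), hcol (by norm_num)]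
      · ring
      all_goals
        rintro t ⟨ht0, ht1⟩
        apply mem_puncturedSquare <;> linarith
    all_goals
      rintro t ⟨ht0, ht1⟩
      apply mem_puncturedSquare <;> linarith

/-- The winding number of the closed curve that consists of `f`, `g` and the reverse of `h` is
constant on preconnected sets off the curve. -/
theorem logIncrement_triangle_eq {f g h : ℝ → ℂ} {a b c d a' b' : ℝ} (hab : a ≤ b) (hcd : c ≤ d)
    (hab' : a' ≤ b') (hf : Continuous f) (hg : Continuous g) (hh : Continuous h)
    (hfg : f b = g c) (hgh : g d = h b') (hfh : f a = h a') {K : Set ℂ} (hK : IsPreconnected K)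
    (hfK : ∀ t ∈ Icc a b, f t ∉ K) (hgK : ∀ t ∈ Icc c d, g t ∉ K) (hhK : ∀ t ∈ Icc a' b', h t ∉ K)
    {p q : ℂ} (hp : p ∈ K) (hq : q ∈ K) :
    logIncrement (fun t ↦ f t - p) a b + logIncrement (fun t ↦ g t - p) c d
        - logIncrement (fun t ↦ h t - p) a' b' =
      logIncrement (fun t ↦ f t - q) a b + logIncrement (fun t ↦ g t - q) c d
        - logIncrement (fun t ↦ h t - q) a' b' := by
  have hcont : ∀ {k : ℝ → ℂ} {a b : ℝ}, a ≤ b → Continuous k → (∀ t ∈ Icc a b, k t ∉ K) →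
      ContinuousOn (fun p : ℂ ↦ logIncrement (fun t ↦ k t - p) a b) K := fun hab hk hkK ↦
    (continuousOn_logIncrement_sub hab hk.continuousOn).mono
      fun p hp ⟨t, ht, e⟩ ↦ hkK t ht (e ▸ hp)
  -- The exponential is a product of quotients of end values, which telescopes because the curve
  -- closes up.
  refine hK.eq_of_exp_eq_one (((hcont hab hf hfK).add (hcont hcd hg hgK)).sub
    (hcont hab' hh hhK)) (fun r hr ↦ ?_) hp hq
  have hne : ∀ {k : ℝ → ℂ} {a b : ℝ}, (∀ t ∈ Icc a b, k t ∉ K) → ∀ t ∈ Icc a b, k t - r ≠ 0 :=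
    fun hkK t ht e ↦ hkK t ht (sub_eq_zero.1 e ▸ hr)
  simp only [Pi.sub_apply, Pi.add_apply]
  rw [Complex.exp_sub, Complex.exp_add, exp_logIncrement hab (by fun_prop) (hne hfK),
    exp_logIncrement hcd (by fun_prop) (hne hgK), exp_logIncrement hab' (by fun_prop) (hne hhK),
    hfg, hgh, hfh]
  have h1 := hne hgK c (left_mem_Icc.2 hcd)
  have h2 := hne hhK a' (left_mem_Icc.2 hab')
  have h3 := hne hhK b' (right_mem_Icc.2 hab')
  field_simp

/-- Let three arcs from `x` to `y` meet only in their ends, and let the middles of any two of them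
be joined by a curve that avoids the third arc. Then the union of these curves separates
`x` from `y`. -/
theorem not_isPreconnected_of_three_arcs {γ σ : Fin 3 → ℝ → ℂ} {x y : ℂ}
    (hγ : ∀ i, Continuous (γ i)) (hσ : ∀ i, Continuous (σ i))
    (hγ0 : ∀ i, γ i 0 = x) (hγ1 : ∀ i, γ i 1 = y)
    (hσ0 : ∀ i, σ i 0 = γ (i + 1) (1 / 2)) (hσ1 : ∀ i, σ i 1 = γ (i + 2) (1 / 2))
    (hγne : ∀ i j, i ≠ j → ∀ q ∈ puncturedSquare, γ i q.1 ≠ γ j q.2)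
    (hσγ : ∀ i, ∀ s ∈ Icc (0 : ℝ) 1, ∀ t ∈ Icc (0 : ℝ) 1, σ i s ≠ γ i t)
    {K : Set ℂ} (hxK : x ∈ K) (hyK : y ∈ K) (hσK : ∀ i, ∀ t ∈ Icc (0 : ℝ) 1, σ i t ∉ K) :
    ¬ IsPreconnected K := by
  intro hK
  have h02 : (0 : ℝ) ≤ 1 / 2 := by norm_num
  have h21 : (1 / 2 : ℝ) ≤ 1 := by norm_num
  have hleft : Icc (0 : ℝ) (1 / 2) ⊆ Icc 0 1 := Icc_subset_Icc_right h21
  have hright : Icc (1 / 2 : ℝ) 1 ⊆ Icc 0 1 := Icc_subset_Icc_left h02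
  have hmem : ∀ s ∈ Icc (0 : ℝ) (1 / 2), ∀ t ∈ Icc (1 / 2 : ℝ) 1, (s, t) ∈ puncturedSquare := by
    rintro s ⟨hs0, hs1⟩ t ⟨ht0, ht1⟩
    apply mem_puncturedSquare <;> linarith
  have hmid : ∀ t ∈ Icc (0 : ℝ) 1, (t, 1 / 2) ∈ puncturedSquare := by
    rintro t ⟨ht0, ht1⟩
    apply mem_puncturedSquare <;> linarith
  -- The second half of `γ k` joins its middle to `y` off the triangle with corner `x`.
  have hx : ∀ i j k : Fin 3, k ≠ i → k ≠ j → σ k 0 = γ i (1 / 2) → σ k 1 = γ j (1 / 2) →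
      logIncrement (fun t ↦ γ i t - y) 0 (1 / 2) + logIncrement (fun t ↦ σ k t - y) 0 1
        - logIncrement (fun t ↦ γ j t - y) 0 (1 / 2) =
      logIncrement (fun t ↦ γ i t - γ k (1 / 2)) 0 (1 / 2)
        + logIncrement (fun t ↦ σ k t - γ k (1 / 2)) 0 1
        - logIncrement (fun t ↦ γ j t - γ k (1 / 2)) 0 (1 / 2) := fun i j k hki hkj h h' ↦ by
    refine logIncrement_triangle_eq h02 zero_le_one h02 (hγ i) (hσ k) (hγ j) h.symm h'
      ((hγ0 i).trans (hγ0 j).symm) (isPreconnected_Icc.image (γ k) (hγ k).continuousOn) ?_ ?_ ?_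
      ⟨1, ⟨h21, le_rfl⟩, hγ1 k⟩ ⟨1 / 2, ⟨le_rfl, h21⟩, rfl⟩
    · rintro s hs ⟨t, ht, e⟩
      exact hγne i k hki.symm _ (hmem s hs t ht) e.symm
    · rintro s hs ⟨t, ht, e⟩
      exact hσγ k s hs t (hright ht) e.symm
    · rintro s hs ⟨t, ht, e⟩
      exact hγne j k hkj.symm _ (hmem s hs t ht) e.symm
  -- Likewise for the triangle with corner `y`, using the first half of `γ k`, which ends in `x`.
  have hy : ∀ i j k : Fin 3, k ≠ i → k ≠ j → σ k 0 = γ i (1 / 2) → σ k 1 = γ j (1 / 2) →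
      logIncrement (fun t ↦ σ k t - x) 0 1 + logIncrement (fun t ↦ γ j t - x) (1 / 2) 1
        - logIncrement (fun t ↦ γ i t - x) (1 / 2) 1 =
      logIncrement (fun t ↦ σ k t - γ k (1 / 2)) 0 1
        + logIncrement (fun t ↦ γ j t - γ k (1 / 2)) (1 / 2) 1
        - logIncrement (fun t ↦ γ i t - γ k (1 / 2)) (1 / 2) 1 := fun i j k hki hkj h h' ↦ by
    refine logIncrement_triangle_eq zero_le_one h21 h21 (hσ k) (hγ j) (hγ i) h'
      ((hγ1 j).trans (hγ1 i).symm) h (isPreconnected_Icc.image (γ k) (hγ k).continuousOn) ?_ ?_ ?_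
      ⟨0, ⟨le_rfl, h02⟩, hγ0 k⟩ ⟨1 / 2, ⟨h02, le_rfl⟩, rfl⟩
    · rintro s hs ⟨t, ht, e⟩
      exact hσγ k s hs t (hleft ht) e.symm
    · rintro s hs ⟨t, ht, e⟩
      exact hγne k j hkj _ (hmem t ht s hs) e
    · rintro s hs ⟨t, ht, e⟩
      exact hγne k i hki _ (hmem t ht s hs) e
  have hadd : ∀ i k : Fin 3, i ≠ k →
      logIncrement (fun t ↦ γ i t - γ k (1 / 2)) 0 (1 / 2)
        + logIncrement (fun t ↦ γ i t - γ k (1 / 2)) (1 / 2) 1 =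
      logIncrement (fun t ↦ γ i t - γ k (1 / 2)) 0 1 := fun i k hik ↦
    logIncrement_add h02 h21 ((hγ i).sub continuous_const).continuousOn
      fun t ht ↦ sub_ne_zero.2 (hγne i k hik _ (hmid t ht))
  -- Only here is the connectedness of `K` used. `σ 2` is reversed since the third side of a
  -- triangle is subtracted.
  have hcyc := logIncrement_triangle_eq zero_le_one zero_le_one zero_le_one (hσ 0) (hσ 1)
    (h := fun t ↦ σ 2 (1 - t)) ((hσ 2).comp (by fun_prop)) ((hσ1 0).trans (hσ0 1).symm)
    (by simpa using (hσ1 1).trans (hσ0 2).symm) (by simpa using (hσ0 0).trans (hσ1 2).symm)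
    hK (hσK 0) (hσK 1) (fun t ht ↦ hσK 2 _ ⟨by linarith [ht.2], by linarith [ht.1]⟩) hxK hyK
  have hrev : ∀ p ∈ K, logIncrement (fun t ↦ σ 2 (1 - t) - p) 0 1 =
      -logIncrement (fun t ↦ σ 2 t - p) 0 1 := fun p hp ↦
    logIncrement_reverse (f := fun t ↦ σ 2 t - p) ((hσ 2).sub continuous_const)
      fun t ht e ↦ hσK 2 t ht (sub_eq_zero.1 e ▸ hp)
  rw [hrev x hxK, hrev y hyK] at hcyc
  -- The pairs are taken in cyclic order, so that the terms depending on a single arc cancel in the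
  -- sum.
  obtain ⟨m, hm, em⟩ := exists_logIncrement_sub_eq (hγ 1) (hγ 0) (hγ0 1) (hγ1 1) (hγ0 0) (hγ1 0)
    (hγne 1 0 (by decide))
  obtain ⟨m', hm', em'⟩ := exists_logIncrement_sub_eq (hγ 2) (hγ 1) (hγ0 2) (hγ1 2) (hγ0 1)
    (hγ1 1) (hγne 2 1 (by decide))
  obtain ⟨m'', hm'', em''⟩ := exists_logIncrement_sub_eq (hγ 0) (hγ 2) (hγ0 0) (hγ1 0) (hγ0 2)
    (hγ1 2) (hγne 0 2 (by decide))
  have hx0 := hx 1 2 0 (by decide) (by decide) (hσ0 0) (hσ1 0)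
  have hx1 := hx 2 0 1 (by decide) (by decide) (hσ0 1) (hσ1 1)
  have hx2 := hx 0 1 2 (by decide) (by decide) (hσ0 2) (hσ1 2)
  have hy0 := hy 1 2 0 (by decide) (by decide) (hσ0 0) (hσ1 0)
  have hy1 := hy 2 0 1 (by decide) (by decide) (hσ0 1) (hσ1 1)
  have hy2 := hy 0 1 2 (by decide) (by decide) (hσ0 2) (hσ1 2)
  rw [← hadd 1 0 (by decide), ← hadd 0 1 (by decide)] at em
  rw [← hadd 2 1 (by decide), ← hadd 1 2 (by decide)] at em'
  rw [← hadd 0 2 (by decide), ← hadd 2 0 (by decide)] at em''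
  have hsum : m + m' + m'' = 0 := by
    linear_combination (-em - em' - em'' - hx0 - hx1 - hx2 + hy0 + hy1 + hy2 - hcyc) / 2
  have hexp : Complex.exp (m + m' + m'') = -1 := by
    rw [Complex.exp_add, Complex.exp_add, hm, hm', hm'']
    norm_num
  rw [hsum, Complex.exp_zero] at hexp
  norm_num at hexp

/-! ### Curves in plane graphs -/

namespace PlaneEmbedding

variable {V : Type*} {G : SimpleGraph V}

theorem mem_walkCurve (E : PlaneEmbedding G) {u v : V} {X : G.Walk u v} {p : Plane} :
    p ∈ E.walkCurve X ↔ ∃ e : G.edgeSet, (e : Sym2 V) ∈ X.edges ∧ p ∈ E.curve e := by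
  simp [walkCurve]

theorem walkCurve_mono (E : PlaneEmbedding G) {u v u' v' : V} {X : G.Walk u v}
    {Y : G.Walk u' v'} (h : X.edges ⊆ Y.edges) : E.walkCurve X ⊆ E.walkCurve Y := by
  intro p hp
  obtain ⟨e, he, hpe⟩ := E.mem_walkCurve.1 hp
  exact E.mem_walkCurve.2 ⟨e, h he, hpe⟩

theorem point_notMem_walkCurve (E : PlaneEmbedding G) {u v w : V} {X : G.Walk u v}
    (hw : w ∉ X.support) : E.point w ∉ E.walkCurve X := by
  intro hp
  obtain ⟨e, he, hpe⟩ := E.mem_walkCurve.1 hp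
  exact hw (X.mem_support_of_mem_edges he (E.mem_of_point_mem_curve e w hpe))

/-- The curve of a walk with at least one edge is traversed by a path. -/
theorem exists_path_walkCurve (E : PlaneEmbedding G) {u v : V} (X : G.Walk u v) (hX : ¬ X.Nil) :
    ∃ γ : Path (E.point u) (E.point v), ∀ t, γ t ∈ E.walkCurve X := by
  induction X with
  | nil => simp at hX
  | @cons u w v h p ih =>
    obtain ⟨γ, -, hγ⟩ := E.curve_isArc u w h
    have hγp : ∀ t, γ t ∈ E.walkCurve (p.cons h) := fun t ↦
      E.mem_walkCurve.2 ⟨⟨s(u, w), h⟩, by simp, hγ ▸ mem_range_self t⟩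
    by_cases hp : p.Nil
    · cases p with
      | nil => exact ⟨γ, hγp⟩
      | cons => simp at hp
    · obtain ⟨δ, hδ⟩ := ih hp
      refine ⟨γ.trans δ, fun t ↦ ?_⟩
      have ht : (γ.trans δ) t ∈ range γ ∪ range δ := Path.trans_range γ δ ▸ mem_range_self t
      rcases ht with ⟨s, hs⟩ | ⟨s, hs⟩
      · exact hs ▸ hγp s
      · exact hs ▸ E.walkCurve_mono (by simp) (hδ s)

/-- Two edges with a common end form an arc that passes through this end at half time. -/
theorem exists_arc_through (E : PlaneEmbedding G) {x y v : V} (hxy : x ≠ y) (hx : G.Adj x v)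
    (hy : G.Adj y v) :
    ∃ γ : ℝ → Plane, Continuous γ ∧ γ 0 = E.point x ∧ γ (1 / 2) = E.point v ∧ γ 1 = E.point y ∧
      (∀ t, γ t ∈ E.curve ⟨s(x, v), hx⟩ ∨ γ t ∈ E.curve ⟨s(y, v), hy⟩) ∧
      (∀ t ∈ Icc (0 : ℝ) 1, γ t = E.point x → t = 0) ∧
      (∀ t ∈ Icc (0 : ℝ) 1, γ t = E.point y → t = 1) := by
  obtain ⟨γ, hγi, hγ⟩ := E.curve_isArc x v hx
  obtain ⟨δ, hδi, hδ⟩ := E.curve_isArc y v hy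
  have hγx : ∀ t ∈ Icc (0 : ℝ) 1, γ.extend t = E.point x → t = 0 := fun t ht h ↦ by
    rw [Path.extend_apply _ ht] at h
    exact congrArg Subtype.val (hγi (h.trans γ.source.symm))
  have hδy : ∀ t ∈ Icc (0 : ℝ) 1, δ.extend t = E.point y → t = 0 := fun t ht h ↦ by
    rw [Path.extend_apply _ ht] at h
    exact congrArg Subtype.val (hδi (h.trans δ.source.symm))
  have hγm : ∀ t, γ.extend t ∈ E.curve ⟨s(x, v), hx⟩ := fun t ↦ by
    rw [← hγ, ← γ.extend_range]
    exact mem_range_self t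
  have hδm : ∀ t, δ.extend t ∈ E.curve ⟨s(y, v), hy⟩ := fun t ↦ by
    rw [← hδ, ← δ.extend_range]
    exact mem_range_self t
  have hγy : ∀ t, γ.extend t ≠ E.point y := fun t h ↦ by
    have := E.mem_of_point_mem_curve _ _ (h ▸ hγm t)
    rcases Sym2.mem_iff.1 this with h | h
    exacts [hxy h.symm, hy.ne h]
  have hδx : ∀ t, δ.extend t ≠ E.point x := fun t h ↦ by
    have := E.mem_of_point_mem_curve _ _ (h ▸ hδm t)
    rcases Sym2.mem_iff.1 this with h | h
    exacts [hxy h, hx.ne h]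
  have hleft : ∀ t : ℝ, t ≤ 1 / 2 → (γ.trans δ.symm).extend t = γ.extend (2 * t) := fun t ht ↦
    Path.extend_trans_of_le_half _ _ ht
  have hright : ∀ t : ℝ, 1 / 2 ≤ t → (γ.trans δ.symm).extend t = δ.extend (2 - 2 * t) :=
    fun t ht ↦ by
      rw [Path.extend_trans_of_half_le _ _ ht, Path.extend_symm_apply]
      ring_nf
  refine ⟨(γ.trans δ.symm).extend, Path.continuous_extend _, Path.extend_zero _, ?_,
    Path.extend_one _, fun t ↦ ?_, fun t ht h ↦ ?_, fun t ht h ↦ ?_⟩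
  · rw [hleft _ le_rfl]
    norm_num
  · rcases le_total t (1 / 2) with h | h
    · exact .inl (hleft t h ▸ hγm _)
    · exact .inr (hright t h ▸ hδm _)
  · rcases le_total t (1 / 2) with h' | h'
    · have := hγx (2 * t) ⟨by linarith [ht.1], by linarith⟩ (hleft t h' ▸ h)
      linarith
    · exact absurd (hright t h' ▸ h) (hδx _)
  · rcases le_total t (1 / 2) with h' | h'
    · exact absurd (hleft t h' ▸ h) (hγy _)
    · have := hδy (2 - 2 * t) ⟨by linarith [ht.2], by linarith⟩ (hright t h' ▸ h)
      linarith

/-- If `x` and `y` are adjacent to three vertices that are joined pairwise, each pair by a walk that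
avoids the third, then the curves of the walks separate `x` from `y`. -/
theorem not_isPreconnected_of_three_walks (E : PlaneEmbedding G) {x y : V} (hxy : x ≠ y)
    {v : Fin 3 → V} (hv : Function.Injective v) (hx : ∀ i, G.Adj x (v i))
    (hy : ∀ i, G.Adj y (v i)) (W : ∀ i, G.Walk (v (i + 1)) (v (i + 2)))
    (hW : ∀ i, v i ∉ (W i).support) (hxW : ∀ i, x ∉ (W i).support)
    (hyW : ∀ i, y ∉ (W i).support) {K : Set Plane} (hxK : E.point x ∈ K) (hyK : E.point y ∈ K)
    (hK : ∀ i, Disjoint K (E.walkCurve (W i))) : ¬ IsPreconnected K := by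
  intro hconn
  choose γ hγ hγ0 hγv hγ1 hγm hγx hγy using fun i ↦ E.exists_arc_through hxy (hx i) (hy i)
  -- The curve of a trivial walk is empty and would contain no path.
  have hnil : ∀ i, ¬ (W i).Nil := fun i h ↦
    (by decide : ∀ i : Fin 3, i + 1 ≠ i + 2) i (hv h.eq)
  choose τ hτ using fun i ↦ E.exists_path_walkCurve (W i) (hnil i)
  have hcommon : ∀ {e f : G.edgeSet} {p : Plane}, p ∈ E.curve e → p ∈ E.curve f → e ≠ f →
      ∃ w, w ∈ (e : Sym2 V) ∧ w ∈ (f : Sym2 V) ∧ p = E.point w := fun he hf hef ↦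
    E.curve_inter _ _ hef _ ⟨he, hf⟩
  have hγγ : ∀ i j, i ≠ j → ∀ s t, γ i s = γ j t → γ i s = E.point x ∨ γ i s = E.point y := by
    intro i j hij s t h
    have hvij : v i ≠ v j := hv.ne hij
    have hxi := (hx i).ne
    have hxj := (hx j).ne
    have hyi := (hy i).ne
    have hyj := (hy j).ne
    have hj := hγm j t
    rw [← h] at hj
    rcases hγm i s with hi | hi <;> rcases hj with hj | hj <;>
    · obtain ⟨w, hw, hw', hp⟩ := hcommon hi hj (by
        intro e
        have e := Sym2.eq_iff.1 (congrArg Subtype.val e)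
        grind)
      simp only [Sym2.mem_iff] at hw hw'
      grind
  have hγτ : ∀ i s t, τ i s ≠ γ i t := by
    intro i s t h
    obtain ⟨e, he, hp⟩ := E.mem_walkCurve.1 (hτ i s)
    -- An edge off the walk can meet it only in a common vertex, but the walk contains neither end
    -- of this edge.
    have key : ∀ z (hz : G.Adj z (v i)), z ∉ (W i).support →
        τ i s ∉ E.curve ⟨s(z, v i), hz⟩ := by
      intro z hz hzW hp'
      obtain ⟨w, hw, hw', hpw⟩ := hcommon hp hp' (by
        rintro rfl
        exact hzW ((W i).fst_mem_support_of_mem_edges he))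
      have hwW := (W i).mem_support_of_mem_edges he hw
      rcases Sym2.mem_iff.1 hw' with rfl | rfl
      exacts [hzW hwW, hW i hwW]
    rcases hγm i t with h' | h'
    · exact key x (hx i) (hxW i) (h ▸ h')
    · exact key y (hy i) (hyW i) (h ▸ h')
  let Φ : Plane ≃ₜ ℂ := Complex.orthonormalBasisOneI.repr.symm.toHomeomorph
  refine not_isPreconnected_of_three_arcs (γ := fun i t ↦ Φ (γ i t))
    (σ := fun i t ↦ Φ ((τ i).extend t)) (x := Φ (E.point x)) (y := Φ (E.point y))
    (fun i ↦ Φ.continuous.comp (hγ i)) (fun i ↦ Φ.continuous.comp (τ i).continuous_extend)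
    (fun i ↦ by rw [hγ0]) (fun i ↦ by rw [hγ1]) (fun i ↦ by rw [Path.extend_zero, hγv])
    (fun i ↦ by rw [Path.extend_one, hγv]) ?_ ?_ (K := Φ '' K) (mem_image_of_mem Φ hxK)
    (mem_image_of_mem Φ hyK) ?_ (hconn.image Φ Φ.continuous.continuousOn)
  · rintro i j hij ⟨s, t⟩ ⟨hs, ht, h0, h1⟩ h
    have h := Φ.injective h
    rcases hγγ i j hij s t h with hp | hp
    · exact h0 (Prod.ext (hγx i s hs hp) (hγx j t ht (h ▸ hp)))
    · exact h1 (Prod.ext (hγy i s hs hp) (hγy j t ht (h ▸ hp)))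
  · intro i s hs t ht h
    have h := Φ.injective h
    rw [Path.extend_apply _ hs] at h
    exact hγτ i _ t h
  · rintro i t ht ⟨p, hp, h⟩
    rw [Φ.injective.eq_iff, Path.extend_apply _ ht] at h
    exact disjoint_left.1 (hK i) hp (h ▸ hτ i _)

end PlaneEmbedding

/-- A cycle contains three vertices such that any two of them are joined by a part of the cycle that
avoids the third. -/
theorem SimpleGraph.Walk.IsCycle.exists_three_walks {V : Type*} {G : SimpleGraph V} {a : V}
    {X : G.Walk a a} (hX : X.IsCycle) :
    ∃ v : Fin 3 → V, Function.Injective v ∧ (∀ i, v i ∈ X.support) ∧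
      ∀ i, ∃ W : G.Walk (v (i + 1)) (v (i + 2)),
        v i ∉ W.support ∧ W.support ⊆ X.support ∧ W.edges ⊆ X.edges := by
  cases X with
  | nil => exact absurd hX (by simp)
  | @cons _ b _ h p =>
    obtain ⟨hp, he⟩ := (SimpleGraph.Walk.cons_isCycle_iff p h).1 hX
    cases p with
    | nil => exact absurd h (G.irrefl)
    | @cons _ c _ h' q =>
      have hac : a ≠ c := by
        rintro rfl
        exact he (by simp [Sym2.eq_swap])
      obtain ⟨hq, hb⟩ := (SimpleGraph.Walk.cons_isPath_iff h' q).1 hp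
      have hab := h.ne
      have hbc := h'.ne
      -- For three consecutive vertices, two of the walks are single edges, and the one avoiding `b`
      -- is the rest of the cycle.
      refine ⟨![a, b, c], ?_, ?_, ?_⟩
      · intro i j hij
        fin_cases i <;> fin_cases j <;> simp_all
      · intro i
        fin_cases i <;> simp
      · intro i
        fin_cases i
        · exact ⟨.cons h' .nil, by simp [hab, hac], by simp, by simp⟩
        · exact ⟨q, hb, by simp, by simp⟩
        · exact ⟨.cons h .nil, by simp [hac.symm, hbc.symm], by simp, by simp⟩

theorem theorem1 {V : Type*} {G : SimpleGraph V} (E : PlaneEmbedding G)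
    {a : V} (X : G.Walk a a) (hX : X.IsCycle)
    (x : V) (hx : ∀ v ∈ X.support, G.Adj x v) :
    ¬ ∃ y : V, y ≠ x ∧ E.SameSide X x y ∧ ∀ v ∈ X.support, G.Adj y v := by
  rintro ⟨y, hyx, hside, hy⟩
  obtain ⟨v, hv, hvX, hW⟩ := hX.exists_three_walks
  choose W hvW hWs hWe using hW
  have hxX : E.point x ∈ (E.walkCurve X)ᶜ := connectedComponentIn_nonempty_iff.1 ⟨_, hside⟩
  -- Neither `x` nor `y` is on the cycle, as it would be adjacent to itself.
  refine E.not_isPreconnected_of_three_walks hyx.symm hv (fun i ↦ hx _ (hvX i))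
    (fun i ↦ hy _ (hvX i)) W hvW (fun i h ↦ G.irrefl (hx x (hWs i h)))
    (fun i h ↦ G.irrefl (hy y (hWs i h))) (mem_connectedComponentIn hxX) hside (fun i ↦ ?_)
    isPreconnected_connectedComponentIn
  exact disjoint_left.2 fun p hp hpW ↦
    connectedComponentIn_subset _ _ hp (E.walkCurve_mono (hWe i) hpW)
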